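/- For points $a,b\in\mathbb{R}^3$, we say that two edges $\{a,b\}$ and $\{c,d\}$ \emph{cross} if the (relative) interiors of the triangles $\{0,a,b\}$ and $\{0,c,d\}$ intersect. We say that an edge $\{a,b\}$ \emph{passes through} a triangle $\{x,y,z\}$ if the segment from $a$ to $b$ meets the convex hull of $\{x,y,z\}$. We say that the directed segment from $v$ to $w$ \emph{crosses the segment $\{a,b\}$ at} $t\in(0,1)$ if the interiors of the triangles $\{0,v,w\}$ and $\{0,a,b\}$ have a common point on the ray from $0$ through $(1-t)v+tw$, and that it crosses $\{c,d\}$ \emph{before} $\{a,b\}$ if it crosses $\{c,d\}$ at some $s$ and $\{a,b\}$ at some $t$ with $s<t$. \textbf{Lemma.} There does not exist a set $S=\{0,v,w,u_1,u_2,u_1',u_2'\}$ of seven distinct points in $\mathbb{R}^3$ whose pairwise distances are at least $2$ and that satisfies all of the following conditions. \begin{itemize} \item The edges $\{u_1,u_2\}$ and $\{u_1',u_2'\}$ do not cross. \item The edges $\{u_1,u_2\}$ and $\{u_1',u_2'\}$ both pass through the triangle $\{0,v,w\}$. \item $\|u\|\le 2.51$ for all $u\in S$. \item $\|v-w\|=2$.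 \item $\|u_1-u_2\|\le 3.2$ and $\|u_1'-u_2'\|\le 3.2$. \item $u_1$ and $u_1'$ lie in the same open half-space bounded by the plane through $0,v,w$. \item The directed segment from $v$ to $w$ crosses the segment $\{u_1',u_2'\}$ before the segment $\{u_1,u_2\}$. \end{itemize} -/

import Mathlib

/-- Euclidean three-space. -/
abbrev E3 : Type := EuclideanSpace ℝ (Fin 3)

/-- The (relative) interior of the triangle with vertices `a`, `b`, `c`: the points all of whose
barycentric weights are positive. -/
def openTriangle (a b c : E3) : Set E3 :=
  {x | ∃ α β γ : ℝ, 0 < α ∧ 0 < β ∧ 0 < γ ∧ α + β + γ = 1 ∧ x = α • a + β • b + γ • c}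

/-- The edges `{a, b}` and `{c, d}` cross: the interiors of the triangles `{0, a, b}` and
`{0, c, d}` intersect. -/
def EdgesCross (a b c d : E3) : Prop :=
  (openTriangle 0 a b ∩ openTriangle 0 c d).Nonempty

/-- The edge `{a, b}` passes through the triangle `{x, y, z}`: the segment from `a` to `b` meets
the triangle. -/
def PassesThrough (a b x y z : E3) : Prop :=
  (segment ℝ a b ∩ convexHull ℝ {x, y, z}).Nonempty

/-- The directed segment from `v` to `w` crosses the segment `{a, b}` at time `t`: the interiors of
the triangles `{0, v, w}` and `{0, a, b}` have a common point on the ray from `0` through the point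
`(1 - t) v + t w` of the segment. -/
def CrossesAt (v w a b : E3) (t : ℝ) : Prop :=
  0 < t ∧ t < 1 ∧ ∃ r : ℝ, 0 < r ∧
    r • ((1 - t) • v + t • w) ∈ openTriangle 0 v w ∩ openTriangle 0 a b

/-- Two edges cross exactly when the first, as a directed segment, crosses the other at some
time. -/
theorem edgesCross_iff_exists_crossesAt (v w a b : E3) :
    EdgesCross v w a b ↔ ∃ t, CrossesAt v w a b t := by
  constructor
  · rintro ⟨x, hx⟩
    obtain ⟨⟨α, β, γ, hα, hβ, hγ, hsum, rfl⟩, -⟩ := id hx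
    have hpos : 0 < β + γ := by linarith
    refine ⟨γ / (β + γ), by positivity, by rw [div_lt_one hpos]; linarith, β + γ, hpos, ?_⟩
    convert hx using 1
    have h1 : (β + γ) * (1 - γ / (β + γ)) = β := by field_simp; ring
    have h2 : (β + γ) * (γ / (β + γ)) = γ := by field_simp
    rw [smul_add, smul_smul, smul_smul, h1, h2, smul_zero, zero_add]
  · rintro ⟨t, -, -, r, -, h⟩
    exact ⟨_, h⟩

/-- The directed segment from `v` to `w` crosses the segment `{c, d}` before the segment
`{a, b}`. -/
def CrossesBefore (v w c d a b : E3) : Prop :=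
  ∃ s t : ℝ, s < t ∧ CrossesAt v w c d s ∧ CrossesAt v w a b t

/-! Any edge of length at most 3.2 through the triangle `{0, v, w}`, with ends at distance at least
2 from its vertices, lies close to one fixed model edge: the segment of length 2.8 normal to the
plane, centred above the midpoint of `{v, w}` at half the height of `0`. The squared distances from
its ends to those of the model add up to less than 2 (`ends_near_axis`). Two such edges with `u₁`,
`u₁'` on the same side are compared with the same model ends, so the parallelogram law gives `|u₁ -
u₁'|² + |u₂ - u₂'|² < 2 (2 + 2) = 8`, whereas separation forces at least 8.

Closeness is proved for the midpoint `m` and half-edge `d` in `IsNarrowTriangle.edge_near_axis`.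
Averaging the distance conditions with suitable weights confines the crossing point `p` and the
midpoint, then bounds the components of `d` parallel to the plane; `tilt_bound` turns this into the
final inequality. -/

/-! ### Distances from a point to a segment with far ends. -/

/-- If every vertex of a triangle is at distance at least `2` from both ends `p + (1 + ν) d` and
`p - (1 - ν) d` of a segment with half-length at most `1.6`, then it is at distance at least `1.2`
from the point `p` of the segment. -/
theorem le_sq_dist_point_of_endpoints {a b ν d₁ d₂ d₃ : ℝ} (hν₀ : -1 ≤ ν) (hν₁ : ν ≤ 1)
    (hD : d₁ ^ 2 + d₂ ^ 2 + d₃ ^ 2 ≤ 2.56)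
    (h₁ : 4 ≤ (a + (1 + ν) * d₁) ^ 2 + (b + (1 + ν) * d₂) ^ 2 + ((1 + ν) * d₃) ^ 2)
    (h₂ : 4 ≤ (a - (1 - ν) * d₁) ^ 2 + (b - (1 - ν) * d₂) ^ 2 + ((1 - ν) * d₃) ^ 2) :
    1.44 ≤ a ^ 2 + b ^ 2 := by
  -- Stewart's identity: these weights cancel the terms linear in `d`, leaving `|p - g|² ≥ 4 - (1 -
  -- ν²)|d|²`, and 4 - 2.56 = 1.44.
  have e₁ := mul_nonneg (sub_nonneg.2 hν₁) (sub_nonneg.2 h₁)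
  have e₂ := mul_nonneg (by linarith : 0 ≤ 1 + ν) (sub_nonneg.2 h₂)
  have e₃ : (1 - ν ^ 2) * (d₁ ^ 2 + d₂ ^ 2 + d₃ ^ 2) ≤ d₁ ^ 2 + d₂ ^ 2 + d₃ ^ 2 := by
    nlinarith [mul_nonneg (sq_nonneg ν) (by positivity : 0 ≤ d₁ ^ 2 + d₂ ^ 2 + d₃ ^ 2)]
  linarith

/-- Comparison of the distances from a point `g` to the point `p` and to the midpoint `p + ν d` of a
segment, when `p` is at squared distance at least `4 - q ≥ |p - g| ^ 2` from both its ends. -/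
theorem sq_dist_midpoint_le {a b ν d₁ d₂ d₃ q : ℝ} (hν₀ : -1 ≤ ν) (hν₁ : ν ≤ 1)
    (h₁ : 4 - q ≤ (1 + ν) ^ 2 * (d₁ ^ 2 + d₂ ^ 2 + d₃ ^ 2))
    (h₂ : 4 - q ≤ (1 - ν) ^ 2 * (d₁ ^ 2 + d₂ ^ 2 + d₃ ^ 2))
    (hq : a ^ 2 + b ^ 2 + q ≤ 4) :
    (a + ν * d₁) ^ 2 + (b + ν * d₂) ^ 2 + (ν * d₃) ^ 2 ≤
      a ^ 2 + b ^ 2 + q + (d₁ ^ 2 + d₂ ^ 2 + d₃ ^ 2) - 4 := by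
  -- Here `I` is the inner product of `p - g` with `d`, up to sign, and `μ = |ν|`. Cauchy–Schwarz
  -- gives `I ≤ (1 - μ) D`, and `2μ(1 - μ) + μ² = 1 - (1 - μ)²`.
  have key : ∀ I D N μ : ℝ, 0 ≤ μ → μ ≤ 1 → 0 ≤ D → I ^ 2 ≤ N * D → N ≤ 4 - q →
      4 - q ≤ (1 - μ) ^ 2 * D → N + 2 * μ * I + μ ^ 2 * D ≤ N + q + D - 4 := by
    intro I D N μ hμ₀ hμ₁ hD hI hN hq
    have hI' : I ≤ (1 - μ) * D := by
      refine abs_le_of_sq_le_sq' ?_ (mul_nonneg (by linarith) hD) |>.2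
      nlinarith [mul_le_mul_of_nonneg_right (hN.trans hq) hD]
    nlinarith [mul_le_mul_of_nonneg_left hI' hμ₀]
  have hD : 0 ≤ d₁ ^ 2 + d₂ ^ 2 + d₃ ^ 2 := by positivity
  have hCS : (a * d₁ + b * d₂) ^ 2 ≤ (a ^ 2 + b ^ 2) * (d₁ ^ 2 + d₂ ^ 2 + d₃ ^ 2) := by
    nlinarith [sq_nonneg (a * d₂ - b * d₁), sq_nonneg (a * d₃), sq_nonneg (b * d₃)]
  rcases le_total 0 ν with h | h
  · have := key (a * d₁ + b * d₂) _ _ ν h hν₁ hD hCS (by linarith) h₂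
    linarith
  · have := key (-(a * d₁ + b * d₂)) _ (a ^ 2 + b ^ 2) (-ν) (by linarith) (by linarith) hD (by linarith)
      (by linarith) (by linarith)
    linarith

/-! ### Numerical bounds for narrow triangles. -/

/-- The triangle with vertices `(-1, 0)`, `(1, 0)`, `(s, t)` has sides of length between `2` and
`2.51`, and `s ≥ 0`. -/
structure IsNarrowTriangle (s t : ℝ) : Prop where
  s_nonneg : 0 ≤ s
  t_pos : 0 < t
  le_right : 4 ≤ (1 - s) ^ 2 + t ^ 2
  left_le : (1 + s) ^ 2 + t ^ 2 ≤ 6.3001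

namespace IsNarrowTriangle

theorem s_le {s t : ℝ} (h : IsNarrowTriangle s t) : s ≤ 0.5751 := by
  have := h.le_right
  have := h.left_le
  nlinarith

theorem t_ge {s t : ℝ} (h : IsNarrowTriangle s t) : 1.732 ≤ t := by
  have := h.le_right
  nlinarith [h.s_le, h.s_nonneg, h.t_pos]

theorem t_le {s t : ℝ} (h : IsNarrowTriangle s t) : t ≤ 2.3023 := by
  have := h.left_le
  nlinarith [h.s_le, h.s_nonneg, h.t_pos]

theorem t_sq_le {s t : ℝ} (h : IsNarrowTriangle s t) : t ^ 2 ≤ 5.3001 - 2 * s - s ^ 2 := by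
  have := h.left_le
  nlinarith

/-- A point of the triangle at distance at least `1.2` from the vertex `(s, t)`. -/
theorem weight_le {s t x τ : ℝ} (h : IsNarrowTriangle s t) (hτ : τ ≤ 1)
    (hl : s * τ - (1 - τ) ≤ x) (hr : x ≤ s * τ + (1 - τ))
    (hd : 1.44 ≤ (x - s) ^ 2 + (τ * t - t) ^ 2) : τ ≤ 0.522 := by
  have h₁ := h.left_le
  have hs := h.s_nonneg
  -- The distance to the apex is at most `1 - τ` times the longest side, and 1 - 1.2/2.51 < 0.522.
  have : (x - s) ^ 2 + (τ * t - t) ^ 2 ≤ (1 - τ) ^ 2 * 6.3001 := by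
    have hx : (x - s * τ + s * τ - s) ^ 2 ≤ ((1 - τ) * (1 + s)) ^ 2 := by
      apply sq_le_sq'
      · nlinarith
      · nlinarith [mul_nonneg hs (sub_nonneg.2 hτ)]
    nlinarith [sq_nonneg (1 - τ)]
  nlinarith

/-- The deviation from the normal direction, across the altitude, is small. -/
theorem altitude_bound {s t x τ : ℝ} (h : IsNarrowTriangle s t) (hτ : 0.45 ≤ τ)
    (hl : s * τ - (1 - τ) ≤ x) :
    (s ^ 2 + t ^ 2 - 1) / 2 - 0.88 - 2 * s * x - (1 - s ^ 2) * τ ≤ 0.39 * t := by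
  have h₁ := h.t_sq_le
  have h₂ := h.s_nonneg
  have h₃ := h.s_le
  have h₄ := h.t_ge
  have h₅ := h.t_le
  have e₁ : -(2 * s * x) ≤ 2 * s * (1 - τ - s * τ) := by nlinarith
  -- After `e₁` the coefficient of `τ` is `-(1 + s)²`, so `τ = 0.45` is the worst case.
  have e₂ : (1 + s) ^ 2 * 0.45 ≤ (1 + s) ^ 2 * τ := by gcongr
  have e₃ : t ^ 2 / 2 - 1.83 + 1.1 * s + 0.05 * s ^ 2 ≤ 0.39 * t := by
    rcases le_total t 2 with ht | ht
    · nlinarith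
    · nlinarith [sq_nonneg (s - 0.43), mul_nonneg (sub_nonneg.2 ht) (sub_nonneg.2 h₅)]
  nlinarith

/-- The deviation across the altitude for points of the triangle near the base. -/
theorem altitude_bound' {s t x τ : ℝ} (h : IsNarrowTriangle s t) (hτ₀ : 0.2 ≤ τ) (hτ₁ : τ ≤ 0.45)
    (hx : 2 * |x| ≤ (s ^ 2 + t ^ 2 - 1) * τ - 0.88) :
    (s ^ 2 + t ^ 2 - 1) / 2 - 0.88 - 2 * s * x - (1 - s ^ 2) * τ ≤ 0.48 * t := by
  have h₁ := h.t_sq_le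
  have h₂ := h.s_nonneg
  have h₃ := h.s_le
  have h₄ := h.t_ge
  have h₅ := h.t_le
  have e₁ : -(2 * s * x) ≤ s * ((s ^ 2 + t ^ 2 - 1) * τ - 0.88) := by
    nlinarith [neg_abs_le x]
  obtain ⟨L, hL⟩ : ∃ L, L = s ^ 2 + t ^ 2 - 1 := ⟨_, rfl⟩
  rw [← hL] at e₁ ⊢
  have hL' : L ≤ 4.3001 - 2 * s := by linarith
  -- After `e₁` the bound is affine in `τ`, so the two endpoints 0.2 and 0.45 suffice.
  have b₀ : L / 2 - 0.88 + s * (L * 0.2 - 0.88) - (1 - s ^ 2) * 0.2 ≤ 0.48 * t := by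
    nlinarith
  have b₁ : L / 2 - 0.88 + s * (L * 0.45 - 0.88) - (1 - s ^ 2) * 0.45 ≤ 0.48 * t := by
    nlinarith
  nlinarith [mul_le_mul_of_nonneg_left b₀ (sub_nonneg.2 hτ₁),
    mul_le_mul_of_nonneg_left b₁ (sub_nonneg.2 hτ₀)]

end IsNarrowTriangle

/-! ### Constraints on the direction of the edge. -/

/-- The final estimate: `d₁` and `d₂` are the deviations of the half-edge `(d₁, d₂, d₃)` from the
normal direction. -/
theorem tilt_bound {d₁ d₂ d₃ τ : ℝ} (hτ₀ : 0.2 ≤ τ) (hτ₁ : τ ≤ 0.522) (hd₃ : 0 ≤ d₃)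
    (hD₀ : 0.7 ≤ d₁ ^ 2 + d₂ ^ 2 + d₃ ^ 2) (hD₁ : d₁ ^ 2 + d₂ ^ 2 + d₃ ^ 2 ≤ 2.56)
    (h₁ : 2 * |d₁| ≤ 4.3001 * τ - 0.88)
    (h₂ : |d₂| ≤ 0.39 ∨ τ ≤ 0.45 ∧ |d₂| ≤ 0.48) :
    2 * (d₁ ^ 2 + d₂ ^ 2 + d₃ ^ 2) - 2.8 * d₃ < 0.7149 + τ := by
  have k₁ : d₁ ^ 2 ≤ ((4.3001 * τ - 0.88) / 2) ^ 2 := by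
    rw [← sq_abs d₁]
    gcongr
    linarith
  by_contra! hc
  obtain ⟨δ, hδ⟩ : ∃ δ, δ = 2.56 - (d₁ ^ 2 + d₂ ^ 2 + d₃ ^ 2) := ⟨_, rfl⟩
  have l₁ : 2.8 * d₃ ≤ 4.4051 - τ - 2 * δ := by linarith
  have l₂ : (2.8 * d₃) ^ 2 ≤ (4.4051 - τ - 2 * δ) ^ 2 := by gcongr
  -- With 7.84 = 2.8², this shows that slack `δ` in the length only helps: the worst case is `|d|² =
  -- 2.56`.
  have l₃ : (4.4051 - τ - 2 * δ) ^ 2 ≤ (4.4051 - τ) ^ 2 - 7.84 * δ := by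
    nlinarith
  have l₄ : 7.84 * (2.56 - d₁ ^ 2 - d₂ ^ 2) ≤ (4.4051 - τ) ^ 2 := by nlinarith
  rcases h₂ with h₂ | ⟨hτ₂, h₂⟩
  · have k₂ : d₂ ^ 2 ≤ 0.39 ^ 2 := by rw [← sq_abs d₂]; gcongr
    nlinarith
  · have k₂ : d₂ ^ 2 ≤ 0.48 ^ 2 := by rw [← sq_abs d₂]; gcongr
    nlinarith

/-- A point at distance at least `2` from the vertices of the triangle with vertices `(-1, 0, 0)`,
`(1, 0, 0)`, `(s, t, 0)` is far from the points of that triangle. -/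
theorem sq_dist_triangle_point_ge {s t x τ e₁ e₂ e₃ : ℝ} (hτ : 0 ≤ τ)
    (hl : s * τ - (1 - τ) ≤ x) (hr : x ≤ s * τ + (1 - τ))
    (hv : 4 ≤ (x + 1 + e₁) ^ 2 + (τ * t + e₂) ^ 2 + e₃ ^ 2)
    (hw : 4 ≤ (x - 1 + e₁) ^ 2 + (τ * t + e₂) ^ 2 + e₃ ^ 2)
    (ho : 4 ≤ (x - s + e₁) ^ 2 + (τ * t - t + e₂) ^ 2 + e₃ ^ 2) :
    4 - ((s ^ 2 + t ^ 2 - 1) * τ + 1 - (x ^ 2 + (τ * t) ^ 2)) ≤ e₁ ^ 2 + e₂ ^ 2 + e₃ ^ 2 := by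
  -- The weights are the barycentric coordinates of `(x, τ t)`, so the terms linear in `e` cancel.
  have k₁ := mul_nonneg hτ (sub_nonneg.2 ho)
  have k₂ := mul_nonneg (by linarith : 0 ≤ (1 - τ - (x - s * τ)) / 2) (sub_nonneg.2 hv)
  have k₃ := mul_nonneg (by linarith : 0 ≤ (1 - τ + (x - s * τ)) / 2) (sub_nonneg.2 hw)
  linarith only [k₁, k₂, k₃]

/-- The deviation of a segment with ends `m + d` and `m - d`, both at distance at least `2` from
`(-1, 0, 0)` and `(1, 0, 0)`, in the direction of these points. -/
theorem deviation_base {m₁ m₂ m₃ d₁ d₂ d₃ : ℝ}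
    (hv₁ : 4 ≤ (m₁ + d₁ + 1) ^ 2 + (m₂ + d₂) ^ 2 + (m₃ + d₃) ^ 2)
    (hv₂ : 4 ≤ (m₁ - d₁ + 1) ^ 2 + (m₂ - d₂) ^ 2 + (m₃ - d₃) ^ 2)
    (hw₁ : 4 ≤ (m₁ + d₁ - 1) ^ 2 + (m₂ + d₂) ^ 2 + (m₃ + d₃) ^ 2)
    (hw₂ : 4 ≤ (m₁ - d₁ - 1) ^ 2 + (m₂ - d₂) ^ 2 + (m₃ - d₃) ^ 2) :
    2 * |d₁| ≤ m₁ ^ 2 + m₂ ^ 2 + m₃ ^ 2 + (d₁ ^ 2 + d₂ ^ 2 + d₃ ^ 2) - 3 := by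
  rcases abs_cases d₁ with ⟨hx, -⟩ | ⟨hx, -⟩ <;> rw [hx]
  -- Opposite ends of the edge are paired with opposite ends of the base.
  · linarith only [hv₂, hw₁]
  · linarith only [hv₁, hw₂]

/-- The deviation along the altitude from `(s, t, 0)`. -/
theorem deviation_altitude {s t m₁ m₂ m₃ d₁ d₂ d₃ : ℝ} (hs₀ : -1 ≤ s) (hs₁ : s ≤ 1)
    (hv₁ : 4 ≤ (m₁ + d₁ + 1) ^ 2 + (m₂ + d₂) ^ 2 + (m₃ + d₃) ^ 2)
    (hv₂ : 4 ≤ (m₁ - d₁ + 1) ^ 2 + (m₂ - d₂) ^ 2 + (m₃ - d₃) ^ 2)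
    (hw₁ : 4 ≤ (m₁ + d₁ - 1) ^ 2 + (m₂ + d₂) ^ 2 + (m₃ + d₃) ^ 2)
    (hw₂ : 4 ≤ (m₁ - d₁ - 1) ^ 2 + (m₂ - d₂) ^ 2 + (m₃ - d₃) ^ 2)
    (ho₁ : 4 ≤ (m₁ + d₁ - s) ^ 2 + (m₂ + d₂ - t) ^ 2 + (m₃ + d₃) ^ 2)
    (ho₂ : 4 ≤ (m₁ - d₁ - s) ^ 2 + (m₂ - d₂ - t) ^ 2 + (m₃ - d₃) ^ 2) :
    t * |d₂| ≤ (m₁ - s) ^ 2 + (m₂ - t / 2) ^ 2 + m₃ ^ 2 + t ^ 2 / 4 + (1 - s ^ 2) / 2 +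
      (d₁ ^ 2 + d₂ ^ 2 + d₃ ^ 2) - 4 := by
  -- These weights average the base vertices to `(s, 0, 0)`, the foot of the altitude, which is then
  -- paired with the apex.
  have hs₀ : 0 ≤ (1 - s) / 2 := by linarith
  have hs₁ : 0 ≤ (1 + s) / 2 := by linarith
  have k₁ := mul_nonneg hs₀ (sub_nonneg.2 hv₁)
  have k₂ := mul_nonneg hs₀ (sub_nonneg.2 hv₂)
  have k₃ := mul_nonneg hs₁ (sub_nonneg.2 hw₁)
  have k₄ := mul_nonneg hs₁ (sub_nonneg.2 hw₂)
  rcases abs_cases d₂ with ⟨hx, -⟩ | ⟨hx, -⟩ <;> rw [hx]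
  · linarith only [k₁, k₃, ho₂, k₂, k₄, ho₁]
  · linarith only [k₂, k₄, ho₁, k₁, k₃, ho₂]

/-- An edge with ends `m + d` and `m - d` at distance at least `2` from the vertices of a narrow
triangle, which passes through the triangle at `p = m - ν d`, is close to the edge from
`(0, t / 2, 1.4)` to `(0, t / 2, -1.4)`. -/
theorem IsNarrowTriangle.edge_near_axis {s t : ℝ} (h : IsNarrowTriangle s t)
    {x τ ν m₁ m₂ m₃ d₁ d₂ d₃ : ℝ} (hτ₀ : 0 ≤ τ) (hτ₁ : τ ≤ 1)
    (hl : s * τ - (1 - τ) ≤ x) (hr : x ≤ s * τ + (1 - τ)) (hν₀ : -1 ≤ ν) (hν₁ : ν ≤ 1)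
    (hm₁ : m₁ = x + ν * d₁) (hm₂ : m₂ = τ * t + ν * d₂) (hm₃ : m₃ = ν * d₃)
    (hD : d₁ ^ 2 + d₂ ^ 2 + d₃ ^ 2 ≤ 2.56) (hd₃ : 0 ≤ m₃ + d₃)
    (hv₁ : 4 ≤ (m₁ + d₁ + 1) ^ 2 + (m₂ + d₂) ^ 2 + (m₃ + d₃) ^ 2)
    (hv₂ : 4 ≤ (m₁ - d₁ + 1) ^ 2 + (m₂ - d₂) ^ 2 + (m₃ - d₃) ^ 2)
    (hw₁ : 4 ≤ (m₁ + d₁ - 1) ^ 2 + (m₂ + d₂) ^ 2 + (m₃ + d₃) ^ 2)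
    (hw₂ : 4 ≤ (m₁ - d₁ - 1) ^ 2 + (m₂ - d₂) ^ 2 + (m₃ - d₃) ^ 2)
    (ho₁ : 4 ≤ (m₁ + d₁ - s) ^ 2 + (m₂ + d₂ - t) ^ 2 + (m₃ + d₃) ^ 2)
    (ho₂ : 4 ≤ (m₁ - d₁ - s) ^ 2 + (m₂ - d₂ - t) ^ 2 + (m₃ - d₃) ^ 2) :
    m₁ ^ 2 + (m₂ - t / 2) ^ 2 + m₃ ^ 2 + (d₁ ^ 2 + d₂ ^ 2 + (d₃ - 1.4) ^ 2) < 1 := by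
  have g₁ := h.t_sq_le
  have g₂ := h.s_nonneg
  have g₃ := h.s_le
  have gt := h.t_pos
  have hs1 : 0 ≤ (1 - s ^ 2) * τ := mul_nonneg (by nlinarith only [g₂, g₃]) hτ₀
  have b₁ := deviation_base hv₁ hv₂ hw₁ hw₂
  have b₂ := deviation_altitude (by linarith only [g₂]) (by linarith only [g₃])
    hv₁ hv₂ hw₁ hw₂ ho₁ ho₂
  rw [hm₁, hm₂, hm₃] at *
  clear hm₁ hm₂ hm₃
  have hτ₂ : τ ≤ 0.522 := h.weight_le hτ₁ hl hr
    (le_sq_dist_point_of_endpoints (d₁ := d₁) (d₂ := d₂) (d₃ := d₃) hν₀ hν₁ hD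
      (by linarith only [ho₁]) (by linarith only [ho₂]))
  have hpv : 1.44 ≤ (x + 1) ^ 2 + (τ * t) ^ 2 :=
    le_sq_dist_point_of_endpoints (d₁ := d₁) (d₂ := d₂) (d₃ := d₃) hν₀ hν₁ hD
      (by linarith only [hv₁]) (by linarith only [hv₂])
  have hpw : 1.44 ≤ (x - 1) ^ 2 + (τ * t) ^ 2 :=
    le_sq_dist_point_of_endpoints (d₁ := d₁) (d₂ := d₂) (d₃ := d₃) hν₀ hν₁ hD
      (by linarith only [hw₁]) (by linarith only [hw₂])
  have r₁ := sq_dist_triangle_point_ge (t := t) (e₁ := (1 + ν) * d₁) (e₂ := (1 + ν) * d₂)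
    (e₃ := (1 + ν) * d₃) hτ₀ hl hr (by linarith only [hv₁]) (by linarith only [hw₁])
    (by linarith only [ho₁])
  have r₂ := sq_dist_triangle_point_ge (t := t) (e₁ := -(1 - ν) * d₁) (e₂ := -(1 - ν) * d₂)
    (e₃ := -(1 - ν) * d₃) hτ₀ hl hr (by linarith only [hv₂]) (by linarith only [hw₂])
    (by linarith only [ho₂])
  clear hv₁ hv₂ hw₁ hw₂ ho₁ ho₂
  -- `q` is the mean squared distance from `p` to the vertices, weighted by the barycentric
  -- coordinates of `p`.
  obtain ⟨q, hq⟩ : ∃ q, q = (s ^ 2 + t ^ 2 - 1) * τ + 1 - (x ^ 2 + (τ * t) ^ 2) := ⟨_, rfl⟩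
  rw [← hq] at r₁ r₂
  replace r₁ : 4 - q ≤ (1 + ν) ^ 2 * (d₁ ^ 2 + d₂ ^ 2 + d₃ ^ 2) := by linarith only [r₁]
  replace r₂ : 4 - q ≤ (1 - ν) ^ 2 * (d₁ ^ 2 + d₂ ^ 2 + d₃ ^ 2) := by linarith only [r₂]
  have hL : (s ^ 2 + t ^ 2 - 1) * τ ≤ 4.3001 * τ :=
    mul_le_mul_of_nonneg_right (by linarith only [g₁, g₂]) hτ₀
  have hDn : 0 ≤ d₁ ^ 2 + d₂ ^ 2 + d₃ ^ 2 := by positivity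
  have hqD : 4 - q ≤ d₁ ^ 2 + d₂ ^ 2 + d₃ ^ 2 := by
    rcases le_total 0 ν with h0 | h0
    · exact r₂.trans (mul_le_of_le_one_left hDn (by nlinarith only [h0, hν₁]))
    · exact r₁.trans (mul_le_of_le_one_left hDn (by nlinarith only [h0, hν₀]))
  have hx : 2 * |x| ≤ (s ^ 2 + t ^ 2 - 1) * τ - 0.88 := by
    rcases abs_cases x with ⟨hx, -⟩ | ⟨hx, -⟩ <;> rw [hx] <;> linarith only [hq, hqD, hD, hpv, hpw]
  have hτ₃ : 0.2 ≤ τ := by linarith only [abs_nonneg x, hx, hL]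
  have hxt : 0 ≤ x ^ 2 + (τ * t) ^ 2 := by positivity
  have hq₁ : q ≤ 3.3 := by linarith only [hq, hL, hτ₂, hxt]
  have hd₃' : 0 ≤ d₃ := by
    have : 0 < 1 + ν := by
      rcases hν₀.lt_or_eq with h0 | h0
      · linarith only [h0]
      · rw [← h0] at r₁
        norm_num at r₁
        linarith only [r₁, hq₁]
    exact nonneg_of_mul_nonneg_right (by linarith only [hd₃] : 0 ≤ (1 + ν) * d₃) this
  have hx1 : |x| ≤ 0.7 := by linarith only [hx, hL, hτ₂]
  have hsx : -(2 * s * x) ≤ 2 * s * 0.7 := by nlinarith only [neg_abs_le x, hx1, g₂]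
  -- The reference points are the midpoint of the base (for `b₁`), the centre of the model edge (for
  -- the conclusion) and the midpoint of the altitude (for `b₂`).
  have c₀ := sq_dist_midpoint_le (a := x) (b := τ * t) hν₀ hν₁ r₁ r₂
    (by linarith only [hq, hL, hτ₂])
  have c₁ := sq_dist_midpoint_le (a := x) (b := τ * t - t / 2) hν₀ hν₁ r₁ r₂
    (by linarith only [hq, hs1, g₁, g₂, sq_nonneg s])
  have c₂ := sq_dist_midpoint_le (a := x - s) (b := τ * t - t / 2) hν₀ hν₁ r₁ r₂
    (by nlinarith only [hq, hs1, g₁, g₂, g₃, hsx])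
  have t₁ : 2 * |d₁| ≤ 4.3001 * τ - 0.88 := by linarith only [b₁, c₀, hD, hL, hq]
  have t₂ : t * |d₂| ≤ (s ^ 2 + t ^ 2 - 1) / 2 - 0.88 - 2 * s * x - (1 - s ^ 2) * τ := by
    linarith only [b₂, c₂, hD, hq]
  have t₃ : |d₂| ≤ 0.39 ∨ τ ≤ 0.45 ∧ |d₂| ≤ 0.48 := by
    rcases le_total τ 0.45 with hτ | hτ
    · exact .inr ⟨hτ, le_of_mul_le_mul_left
        (by linarith only [h.altitude_bound' hτ₃ hτ hx, t₂] : t * |d₂| ≤ t * 0.48) gt⟩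
    · exact .inl (le_of_mul_le_mul_left
        (by linarith only [h.altitude_bound hτ hl, t₂] : t * |d₂| ≤ t * 0.39) gt)
  have fin := tilt_bound hτ₃ hτ₂ hd₃' (by linarith only [hqD, hq₁]) hD t₁ t₃
  -- 1.325025 = 5.3001/4; the constant 0.7149 in `tilt_bound` is just below 2.04 - 1.325025.
  have : t ^ 2 / 4 - (1 - s ^ 2) * τ ≤ 1.325025 - τ := by
    linarith only [g₁, g₂, mul_nonneg (sq_nonneg s) (sub_nonneg.2 hτ₂),
      mul_nonneg g₂ (sub_nonneg.2 g₃)]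
  linarith only [this, fin, c₁, hq]

/-- An edge from `a` to `b` of length at most `3.2` through the triangle with vertices `(-1, 0, 0)`,
`(1, 0, 0)`, `(s, t, 0)` is close to the edge from `(0, t / 2, 1.4)` to `(0, t / 2, -1.4)`. -/
theorem ends_near_axis {s t : ℝ} (ht : 0 < t)
    (hr₁ : 4 ≤ (1 - s) ^ 2 + t ^ 2) (hr₂ : (1 - s) ^ 2 + t ^ 2 ≤ 6.3001)
    (hl₁ : 4 ≤ (1 + s) ^ 2 + t ^ 2) (hl₂ : (1 + s) ^ 2 + t ^ 2 ≤ 6.3001)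
    {l α β γ a₁ a₂ a₃ b₁ b₂ b₃ : ℝ} (hl : 0 ≤ l) (hl' : l ≤ 1)
    (hα : 0 ≤ α) (hβ : 0 ≤ β) (hγ : 0 ≤ γ) (hsum : α + β + γ = 1)
    (h₁ : (1 - l) * a₁ + l * b₁ = α * s - β + γ) (h₂ : (1 - l) * a₂ + l * b₂ = α * t)
    (h₃ : (1 - l) * a₃ + l * b₃ = 0)
    (hD : (a₁ - b₁) ^ 2 + (a₂ - b₂) ^ 2 + (a₃ - b₃) ^ 2 ≤ 3.2 ^ 2) (ha₃ : 0 ≤ a₃)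
    (hva : 4 ≤ (a₁ + 1) ^ 2 + a₂ ^ 2 + a₃ ^ 2) (hvb : 4 ≤ (b₁ + 1) ^ 2 + b₂ ^ 2 + b₃ ^ 2)
    (hwa : 4 ≤ (a₁ - 1) ^ 2 + a₂ ^ 2 + a₃ ^ 2) (hwb : 4 ≤ (b₁ - 1) ^ 2 + b₂ ^ 2 + b₃ ^ 2)
    (hoa : 4 ≤ (a₁ - s) ^ 2 + (a₂ - t) ^ 2 + a₃ ^ 2)
    (hob : 4 ≤ (b₁ - s) ^ 2 + (b₂ - t) ^ 2 + b₃ ^ 2) :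
    a₁ ^ 2 + (a₂ - t / 2) ^ 2 + (a₃ - 1.4) ^ 2 +
      (b₁ ^ 2 + (b₂ - t / 2) ^ 2 + (b₃ + 1.4) ^ 2) < 2 := by
  have hD' : ((a₁ - b₁) / 2) ^ 2 + ((a₂ - b₂) / 2) ^ 2 + ((a₃ - b₃) / 2) ^ 2 ≤ 2.56 := by
    linarith only [hD]
  have half : ∀ y z : ℝ, (y + z) / 2 + (y - z) / 2 = y := fun y z => by ring
  have half' : ∀ y z : ℝ, (y + z) / 2 - (y - z) / 2 = z := fun y z => by ring
  rcases le_total 0 s with hs | hs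
  · have key := IsNarrowTriangle.edge_near_axis ⟨hs, ht, hr₁, hl₂⟩ (x := α * s - β + γ) (τ := α)
      (ν := 2 * l - 1) (m₁ := (a₁ + b₁) / 2) (m₂ := (a₂ + b₂) / 2) (m₃ := (a₃ + b₃) / 2)
      (d₁ := (a₁ - b₁) / 2) (d₂ := (a₂ - b₂) / 2) (d₃ := (a₃ - b₃) / 2) hα
    rw [half, half', half, half', half, half'] at key
    have := key (by linarith) (by linarith) (by linarith) (by linarith) (by linarith)
      (by linarith) (by linarith) (by linarith) hD' ha₃ hva hvb hwa hwb hoa hob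
    linarith only [this]
  -- Reflecting the first coordinate exchanges the base vertices and makes the apex abscissa
  -- nonnegative.
  · have key := IsNarrowTriangle.edge_near_axis (s := -s) (t := t)
      ⟨by linarith, ht, by linarith, by linarith⟩ (x := -(α * s - β + γ)) (τ := α)
      (ν := 2 * l - 1) (m₁ := (-a₁ + -b₁) / 2) (m₂ := (a₂ + b₂) / 2) (m₃ := (a₃ + b₃) / 2)
      (d₁ := (-a₁ - -b₁) / 2) (d₂ := (a₂ - b₂) / 2) (d₃ := (a₃ - b₃) / 2) hα
    rw [half, half', half, half', half, half'] at key
    have := key (by linarith) (by linarith) (by linarith) (by linarith) (by linarith)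
      (by linarith) (by linarith) (by linarith) (by linarith only [hD']) ha₃
      (by linarith only [hwa]) (by linarith only [hwb]) (by linarith only [hva])
      (by linarith only [hvb]) (by linarith only [hoa]) (by linarith only [hob])
    linarith only [this]

/-! ### Coordinates, weights and sides of the plane. -/

/-- Coordinates in which a triangle with vertices `0`, `v`, `w` and `‖v - w‖ = 2` is, after the
translation by `(s, t, 0)`, the triangle with vertices `(s, t, 0)`, `(-1, 0, 0)`, `(1, 0, 0)`. -/
theorem exists_frame {v w : E3} (hvw : ‖v - w‖ = 2) (hv : 2 ≤ ‖v‖) (hv' : ‖v‖ ≤ 2.51)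
    (hw : 2 ≤ ‖w‖) (hw' : ‖w‖ ≤ 2.51) :
    ∃ (L : E3 ≃ₗᵢ[ℝ] E3) (s t : ℝ), 0 < t ∧ L v = !₂[-1 - s, -t, 0] ∧ L w = !₂[1 - s, -t, 0] := by
  obtain ⟨e, he⟩ : ∃ e : E3, e = (1 / 2 : ℝ) • (w - v) := ⟨_, rfl⟩
  obtain ⟨u, hu⟩ : ∃ u : E3, u = -(1 / 2 : ℝ) • (v + w) := ⟨_, rfl⟩
  have hv_eq : v = -u - e := by rw [he, hu]; module
  have hw_eq : w = -u + e := by rw [he, hu]; module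
  have he_norm : ‖e‖ = 1 := by
    rw [he, norm_smul, norm_sub_rev, hvw]; norm_num
  obtain ⟨s, hs⟩ : ∃ s : ℝ, s = inner ℝ e u := ⟨_, rfl⟩
  have hee : inner ℝ e e = (1 : ℝ) := by rw [real_inner_self_eq_norm_sq, he_norm]; norm_num
  have hnv : ‖v‖ ^ 2 = ‖u‖ ^ 2 + 2 * s + 1 := by
    rw [hv_eq, ← neg_add', norm_neg, norm_add_sq_real, he_norm, real_inner_comm, ← hs]; ring
  have hnw : ‖w‖ ^ 2 = ‖u‖ ^ 2 - 2 * s + 1 := by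
    rw [hw_eq, neg_add_eq_sub, norm_sub_sq_real, he_norm, ← hs]; ring
  have hnk : ‖u - s • e‖ ^ 2 = ‖u‖ ^ 2 - s ^ 2 := by
    rw [norm_sub_sq_real, inner_smul_right, norm_smul, he_norm, real_inner_comm, ← hs,
      Real.norm_eq_abs, mul_one, sq_abs]
    ring
  have ht : 0 < ‖u - s • e‖ := by
    have : 0 < ‖u - s • e‖ ^ 2 := by
      rw [hnk]
      have a₁ : 2 ^ 2 ≤ ‖v‖ ^ 2 := by gcongr
      have a₂ : ‖v‖ ^ 2 ≤ 2.51 ^ 2 := by gcongr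
      have a₃ : 2 ^ 2 ≤ ‖w‖ ^ 2 := by gcongr
      have a₄ : ‖w‖ ^ 2 ≤ 2.51 ^ 2 := by gcongr
      nlinarith
    exact (norm_nonneg _).lt_of_ne' fun h0 => by simp [h0] at this
  obtain ⟨t, htd⟩ : ∃ t, t = ‖u - s • e‖ := ⟨_, rfl⟩
  rw [← htd] at ht
  obtain ⟨f, hf⟩ : ∃ f : E3, f = t⁻¹ • (u - s • e) := ⟨_, rfl⟩
  have hu_eq : u = s • e + t • f := by
    rw [hf, smul_smul, mul_inv_cancel₀ ht.ne', one_smul]; abel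
  have hf_norm : ‖f‖ = 1 := by
    rw [hf, norm_smul, ← htd, norm_inv, Real.norm_of_nonneg ht.le, inv_mul_cancel₀ ht.ne']
  have hef : inner ℝ e f = (0 : ℝ) := by
    rw [hf, inner_smul_right, inner_sub_right, inner_smul_right, hee, ← hs]; ring
  obtain ⟨b, hb⟩ := Orthonormal.exists_orthonormalBasis_extension_of_card_eq (𝕜 := ℝ) (E := E3)
    (ι := Fin 3) (by simp) (v := ![e, f, 0]) (s := {0, 1}) (by
      rw [orthonormal_iff_ite]
      rintro ⟨i, rfl | rfl⟩ ⟨j, rfl | rfl⟩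
      · simp [he_norm]
      · simpa [Subtype.ext_iff] using hef
      · simpa [Subtype.ext_iff, real_inner_comm] using hef
      · simp [hf_norm])
  have hb₀ : b 0 = e := hb 0 (by simp)
  have hb₁ : b 1 = f := hb 1 (by simp)
  refine ⟨b.repr, s, t, ht, ?_, ?_⟩
  · rw [hv_eq, hu_eq, ← hb₀, ← hb₁]
    ext i
    fin_cases i <;> (simp; try ring)
  · rw [hw_eq, hu_eq, ← hb₀, ← hb₁]
    ext i
    fin_cases i <;> (simp; try ring)

/-- A point of a segment that lies in the triangle with vertices `0`, `v`, `w`, in weights. -/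
theorem PassesThrough.exists_weights {a b v w : E3} (h : PassesThrough a b 0 v w) :
    ∃ l α β γ : ℝ, 0 ≤ l ∧ l ≤ 1 ∧ 0 ≤ α ∧ 0 ≤ β ∧ 0 ≤ γ ∧ α + β + γ = 1 ∧
      (1 - l) • a + l • b = β • v + γ • w := by
  obtain ⟨p, hp, hp'⟩ := h
  rw [segment_eq_image] at hp
  obtain ⟨l, ⟨hl, hl'⟩, rfl⟩ := hp
  rw [convexHull_insert (by simp), convexHull_pair, mem_convexJoin] at hp'
  obtain ⟨x, hx, y, hy, hxy⟩ := hp'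
  rw [Set.mem_singleton_iff] at hx
  subst hx
  obtain ⟨a₁, b₁, ha₁, hb₁, hab₁, rfl⟩ := hy
  obtain ⟨a₂, b₂, ha₂, hb₂, hab₂, hxy⟩ := hxy
  refine ⟨l, a₂, b₂ * a₁, b₂ * b₁, hl, hl', ha₂, by positivity, by positivity, ?_, ?_⟩
  · rw [add_assoc, ← mul_add, hab₁, mul_one, hab₂]
  · beta_reduce at hxy
    rw [← hxy, smul_zero, zero_add, smul_add, smul_smul, smul_smul]

/-- Points on the same side of a plane through `0` have heights of the same sign. -/
theorem mul_nonneg_of_sSameSide {v w x y : E3} (f : E3 →ₗ[ℝ] ℝ) (hv : f v = 0) (hw : f w = 0)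
    (h : (affineSpan ℝ {0, v, w}).SSameSide x y) : 0 ≤ f x * f y := by
  have hspan : ∀ p ∈ affineSpan ℝ {0, v, w}, f p = 0 := by
    have : affineSpan ℝ {0, v, w} ≤ (LinearMap.ker f).toAffineSubspace := by
      rw [affineSpan_le]
      rintro p (rfl | rfl | rfl) <;> simp [hv, hw]
    intro p hp
    simpa using this hp
  obtain ⟨⟨p, hp, q, hq, hpq⟩, -, -⟩ := h
  have := hpq.map f
  simp only [vsub_eq_sub, map_sub, hspan p hp, hspan q hq, sub_zero] at this
  rcases this with h | h | ⟨r₁, r₂, hr₁, hr₂, h⟩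
  · simp [h]
  · simp [h]
  · simp only [smul_eq_mul] at h
    have : 0 ≤ r₁ * (f x * f y) := by
      rw [← mul_assoc, h, mul_assoc]
      exact mul_nonneg hr₂.le (mul_self_nonneg _)
    exact nonneg_of_mul_nonneg_right this hr₁

/-! ### Two edges near the same model edge. -/

theorem mainTheorem4 :
    ¬ ∃ v w u₁ u₂ u₁' u₂' : E3,
      -- seven distinct points with pairwise distances at least `2`
      [0, v, w, u₁, u₂, u₁', u₂'].Pairwise (fun x y => x ≠ y ∧ 2 ≤ dist x y) ∧
      -- the two edges do not cross
      ¬ EdgesCross u₁ u₂ u₁' u₂' ∧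
      -- both edges pass through the triangle `{0, v, w}`
      PassesThrough u₁ u₂ 0 v w ∧
      PassesThrough u₁' u₂' 0 v w ∧
      (∀ u ∈ [0, v, w, u₁, u₂, u₁', u₂'], ‖u‖ ≤ 2.51) ∧
      ‖v - w‖ = 2 ∧
      ‖u₁ - u₂‖ ≤ 3.2 ∧
      ‖u₁' - u₂'‖ ≤ 3.2 ∧
      -- `u₁` and `u₁'` lie strictly on the same side of the plane through `0`, `v`, `w`
      (affineSpan ℝ {0, v, w}).SSameSide u₁ u₁' ∧
      -- going from `v` to `w`, the edge `{u₁', u₂'}` is crossed before `{u₁, u₂}`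
      CrossesBefore v w u₁' u₂' u₁ u₂ := by
  rintro ⟨v, w, a, b, a', b', hpair, -, hab, hab', hnorm, hvw, hl, hl', hside, -⟩
  simp only [List.pairwise_cons, List.mem_cons, List.not_mem_nil, or_false, forall_eq_or_imp,
    forall_eq, List.Pairwise.nil, and_true, dist_zero_left] at hpair hnorm
  obtain ⟨⟨⟨-, h0v⟩, ⟨-, h0w⟩, ⟨-, h0a⟩, ⟨-, h0b⟩, ⟨-, h0a'⟩, ⟨-, h0b'⟩⟩,
    ⟨-, ⟨-, hva⟩, ⟨-, hvb⟩, ⟨-, hva'⟩, ⟨-, hvb'⟩⟩, ⟨⟨-, hwa⟩, ⟨-, hwb⟩, ⟨-, hwa'⟩, ⟨-, hwb'⟩⟩,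
    ⟨-, ⟨-, haa'⟩, -⟩, ⟨-, -, hbb'⟩, -⟩ := hpair
  obtain ⟨-, hnv, hnw, -⟩ := hnorm
  obtain ⟨L, s, t, ht, hLv, hLw⟩ := exists_frame hvw h0v hnv h0w hnw
  have hdist : ∀ x y : E3, dist x y ^ 2 =
      (L x 0 - L y 0) ^ 2 + (L x 1 - L y 1) ^ 2 + (L x 2 - L y 2) ^ 2 := fun x y => by
    rw [← L.dist_map x y, EuclideanSpace.dist_eq, Real.sq_sqrt (by positivity),
      Fin.sum_univ_three]
    simp [Real.dist_eq, sq_abs]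
  have hge : ∀ x y : E3, 2 ≤ dist x y →
      4 ≤ (L x 0 - L y 0) ^ 2 + (L x 1 - L y 1) ^ 2 + (L x 2 - L y 2) ^ 2 := fun x y h => by
    rw [← hdist]; nlinarith
  have hle : ∀ (x y : E3) (r : ℝ), dist x y ≤ r →
      (L x 0 - L y 0) ^ 2 + (L x 1 - L y 1) ^ 2 + (L x 2 - L y 2) ^ 2 ≤ r ^ 2 := fun x y r h => by
    rw [← hdist]; gcongr
  have hv : L v 0 = -1 - s ∧ L v 1 = -t ∧ L v 2 = 0 := by simp [hLv]
  have hw : L w 0 = 1 - s ∧ L w 1 = -t ∧ L w 2 = 0 := by simp [hLw]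
  have h0 : ∀ i, L 0 i = 0 := fun i => by simp
  rw [← dist_zero_left] at h0v h0w h0a h0b h0a' h0b' hnv hnw
  rw [← dist_eq_norm] at hl hl'
  have gv := hge _ _ h0v
  have gw := hge _ _ h0w
  have lv := hle _ _ _ hnv
  have lw := hle _ _ _ hnw
  simp only [h0, hv, hw] at gv gw lv lw
  have near : ∀ x y : E3, PassesThrough x y 0 v w → dist x y ≤ 3.2 → 2 ≤ dist 0 x →
      2 ≤ dist 0 y → 2 ≤ dist v x → 2 ≤ dist v y → 2 ≤ dist w x → 2 ≤ dist w y →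
      ∀ σ : ℝ, σ = 1 ∨ σ = -1 → 0 ≤ σ * L x 2 →
      (L x 0 + s) ^ 2 + (L x 1 + t / 2) ^ 2 + (σ * L x 2 - 1.4) ^ 2 +
        ((L y 0 + s) ^ 2 + (L y 1 + t / 2) ^ 2 + (σ * L y 2 + 1.4) ^ 2) < 2 := by
    intro x y hxy hd h0x h0y hvx hvy hwx hwy σ hσ hpos
    obtain ⟨l, α, β, γ, hl₀, hl₁, hα, hβ, hγ, hsum, heq⟩ := hxy.exists_weights
    have hcoord : ∀ i, (1 - l) * L x i + l * L y i = β * L v i + γ * L w i := fun i => by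
      simpa using congrArg (fun z => L z i) heq
    have e₁ := hcoord 0
    have e₂ := hcoord 1
    have e₃ := hcoord 2
    have hd := hle _ _ _ hd
    replace h0x := hge _ _ h0x
    replace h0y := hge _ _ h0y
    replace hvx := hge _ _ hvx
    replace hvy := hge _ _ hvy
    replace hwx := hge _ _ hwx
    replace hwy := hge _ _ hwy
    simp only [h0, hv, hw] at e₁ e₂ e₃ h0x h0y hvx hvy hwx hwy
    have hσ2 : σ ^ 2 = 1 := by rcases hσ with rfl | rfl <;> norm_num
    have hsq : ∀ z : ℝ, (σ * z) ^ 2 = z ^ 2 := fun z => by rw [mul_pow, hσ2, one_mul]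
    have key := ends_near_axis (s := s) (t := t) ht (by linarith only [gw])
      (by linarith only [lw]) (by linarith only [gv]) (by linarith only [lv])
      (a₁ := L x 0 + s) (a₂ := L x 1 + t) (a₃ := σ * L x 2)
      (b₁ := L y 0 + s) (b₂ := L y 1 + t) (b₃ := σ * L y 2) hl₀ hl₁ hα hβ hγ hsum
      (by linear_combination e₁ - s * hsum) (by linear_combination e₂ - t * hsum)
      (by linear_combination σ * e₃) (by rw [← mul_sub, hsq]; linarith only [hd]) hpos
      (by rw [hsq]; linarith only [hvx]) (by rw [hsq]; linarith only [hvy])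
      (by rw [hsq]; linarith only [hwx]) (by rw [hsq]; linarith only [hwy])
      (by rw [hsq]; linarith only [h0x]) (by rw [hsq]; linarith only [h0y])
    linarith only [key]
  have hsame : 0 ≤ L a 2 * L a' 2 :=
    mul_nonneg_of_sSameSide ((EuclideanSpace.proj (2 : Fin 3)).toLinearMap ∘ₗ L.toLinearMap)
      (by simpa using hv.2.2) (by simpa using hw.2.2) hside
  -- `σ` orients the normal so that `a` and `a'` are both compared with the upper end of the model
  -- edge.
  obtain ⟨σ, hσ, hσa, hσa'⟩ : ∃ σ : ℝ, (σ = 1 ∨ σ = -1) ∧ 0 ≤ σ * L a 2 ∧ 0 ≤ σ * L a' 2 := by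
    rcases mul_nonneg_iff.1 hsame with ⟨h₁, h₂⟩ | ⟨h₁, h₂⟩
    · exact ⟨1, .inl rfl, by linarith, by linarith⟩
    · exact ⟨-1, .inr rfl, by linarith, by linarith⟩
  have n₁ := near a b hab hl h0a h0b hva hvb hwa hwb σ hσ hσa
  have n₂ := near a' b' hab' hl' h0a' h0b' hva' hvb' hwa' hwb' σ hσ hσa'
  have ga := hge _ _ haa'
  have gb := hge _ _ hbb'
  have hσ2 : ∀ z z' : ℝ, (z - z') ^ 2 = (σ * z - σ * z') ^ 2 := fun z z' => by
    rcases hσ with rfl | rfl <;> ring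
  rw [hσ2 (L a 2)] at ga
  rw [hσ2 (L b 2)] at gb
  -- The squares are the discarded terms of the parallelogram law about each model end.
  linarith only [n₁, n₂, ga, gb, sq_nonneg (L a 0 + s + (L a' 0 + s)),
    sq_nonneg (L a 1 + t / 2 + (L a' 1 + t / 2)), sq_nonneg (σ * L a 2 - 1.4 + (σ * L a' 2 - 1.4)),
    sq_nonneg (L b 0 + s + (L b' 0 + s)), sq_nonneg (L b 1 + t / 2 + (L b' 1 + t / 2)),
    sq_nonneg (σ * L b 2 + 1.4 + (σ * L b' 2 + 1.4))]
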